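/- Let $G$ be a finite group. Write $\mathrm{Irr}(H)$ for the set of irreducible complex characters of a group $H$. For $N\lhd G$, $g\in G$ and $\psi\in\mathrm{Irr}(N)$ let $\psi^g(n)=\psi(gng^{-1})$, let $\mathrm{orb}_G(\psi)=\{\psi^g\mid g\in G\}$, and call $\{g\in G\mid \psi^g=\psi\}$ the stabilizer of $\psi$ in $G$. (a) Let $M\le N$ be proper, nontrivial normal subgroups of $G$. One says that $(G,N,M)$ is a Frobenius triple if $C_G(x)\le N$ for every $1\ne x\in M$. Then $(G,N,M)$ is a Frobenius triple if and only if the stabilizer in $G$ of every nonprincipal character $\theta\in\mathrm{Irr}(M)$ is contained in $N$. (b) Let $N$ be a normal subgroup of $G$, and put $\mathrm{Cl}_G(N)=\{\mathrm{cl}_G(n)\mid n\in N\}$, where $\mathrm{cl}_G(n)$ is the $G$-conjugacy class of $n$, and $\mathrm{Irr}_G(N)=\{\mathrm{orb}_G(\psi)\mid\psi\in\mathrm{Irr}(N)\}$. Suppose that a group $A$ acts on $G$ via automorphisms and that $N$ is $A$-invariant. For $a\in A$ and $\psi\in\mathrm{Irr}(N)$ define $\psi^a$ by $\psi^a(a\cdot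 n)=\psi(n)$ for $n\in N$; then $\psi^a\in\mathrm{Irr}(N)$. The group $A$ acts on $\mathrm{Cl}_G(N)$ by $a\cdot\mathrm{cl}_G(n)=\mathrm{cl}_G(a\cdot n)$ and on $\mathrm{Irr}_G(N)$ by $a\cdot\mathrm{orb}_G(\psi)=\mathrm{orb}_G(\psi^a)$, and each $a\in A$ fixes the same (finite) number of elements in $\mathrm{Cl}_G(N)$ and in $\mathrm{Irr}_G(N)$. -/

import Mathlib

namespace FrobeniusTriple

/-- The set `Irr(H)` of irreducible complex characters of `H`, as functions `H → ℂ`. -/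
def Irr (H : Type*) [Group H] : Set (H → ℂ) :=
  {χ | ∃ (V : Type) (_ : AddCommGroup V) (_ : Module ℂ V) (_ : FiniteDimensional ℂ V)
    (ρ : Representation ℂ H V), ρ.IsIrreducible ∧ ρ.character = χ}

section

variable {G : Type*} [Group G]

/-- `(G, N, M)` is a Frobenius triple: `M ≤ N` are nontrivial proper normal subgroups of `G`, and
`C_G(x) ≤ N` for every `1 ≠ x ∈ M`. -/
structure IsFrobeniusTriple (N M : Subgroup G) : Prop where
  normal_top : N.Normal
  normal_bot : M.Normal
  le : M ≤ N
  bot_ne_bot : M ≠ ⊥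
  bot_ne_top : M ≠ ⊤
  top_ne_bot : N ≠ ⊥
  top_ne_top : N ≠ ⊤
  centralizer_le : ∀ x ∈ M, x ≠ 1 → Subgroup.centralizer {x} ≤ N

/-- The conjugate `ψ^g` of a function on a normal subgroup: `ψ^g(n) = ψ(g n g⁻¹)`. -/
def conjFun (N : Subgroup G) [N.Normal] (ψ : N → ℂ) (g : G) : N → ℂ :=
  fun n => ψ (MulAut.conjNormal g n)

/-- The stabilizer in `G` of a function `ψ` on a normal subgroup. -/
def stabilizer (N : Subgroup G) [N.Normal] (ψ : N → ℂ) : Subgroup G where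
  carrier := {g | conjFun N ψ g = ψ}
  one_mem' := by
    funext n
    simp [conjFun]
  mul_mem' := by
    intro a b ha hb
    funext n
    have h1 := congrFun ha (MulAut.conjNormal b n)
    have h2 := congrFun hb n
    simp only [conjFun] at h1 h2
    simp only [conjFun, map_mul, MulAut.mul_apply]
    rw [h1, h2]
  inv_mem' := by
    intro a ha
    funext n
    have h := congrFun ha (MulAut.conjNormal a⁻¹ n)
    simp only [conjFun, ← MulAut.mul_apply, ← map_mul, mul_inv_cancel, map_one,
      MulAut.one_apply] at h
    exact h.symm

/-- The `G`-orbit of a function `ψ` on a normal subgroup. -/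
def orb (N : Subgroup G) [N.Normal] (ψ : N → ℂ) : Set (N → ℂ) :=
  Set.range (conjFun N ψ)

/-- `Cl_G(N)`: the conjugacy classes of `G` of the elements of `N`. -/
def Cl (N : Subgroup G) : Set (Set G) :=
  {κ | ∃ n ∈ N, conjugatesOf n = κ}

/-- `Irr_G(N)`: the `G`-orbits of the irreducible characters of `N`. -/
def IrrOrb (N : Subgroup G) [N.Normal] : Set (Set (N → ℂ)) :=
  {l | ∃ ψ ∈ Irr N, orb N ψ = l}

/-- For `A` acting on `G` by automorphisms and leaving `N` invariant, the function `ψ^a` on `N`,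
determined by `ψ^a(a • n) = ψ(n)`. -/
def actFun {A : Type*} [Group A] [MulDistribMulAction A G] (N : Subgroup G)
    (hN : ∀ (a : A), ∀ n ∈ N, a • n ∈ N) (a : A) (ψ : N → ℂ) : N → ℂ :=
  fun n => ψ ⟨a⁻¹ • (n : G), hN a⁻¹ n n.2⟩

end

end FrobeniusTriple

/-! Both parts rest on Brauer's permutation lemma (`card_fixed_conjClasses_eq_card_fixed_Irr`): an
automorphism of a finite group fixes as many conjugacy classes as irreducible characters.
Precomposition with its inverse permutes two bases of the space of class functions, the class
indicators and the irreducible characters, and its trace counts the fixed members of either basis.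

For (a), apply this to conjugation by `g` on `M`. The trivial class and the principal character are
always fixed, so `g` fixes a nonprincipal character iff it fixes a nontrivial class of `M`; the
latter holds iff some element of the coset `Mg` centralizes some `1 ≠ x ∈ M`. Since `M ≤ N`, that
element lies in `N` iff `g` does.

For (b), apply it to `a` followed by conjugation by `g` on `N`, and sum over `g ∈ G`. A twisted form
of Burnside's orbit count (`sum_card_fixed_eq_card_mul_card_fixed`) turns each sum into `|G|` times
the number of `a`-fixed `G`-orbits. -/

namespace FrobeniusTriple

open Representation

/-! ### Irreducible characters: invariance and orthonormality -/

/-- An isomorphism of representations along an isomorphism of groups identifies the lattices of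
subrepresentations. -/
def subrepresentationOrderIso {H H' V W : Type*} [Group H] [Group H'] [AddCommGroup V] [Module ℂ V]
    [AddCommGroup W] [Module ℂ W] {ρ : Representation ℂ H V} {τ : Representation ℂ H' W}
    (φ : H ≃* H') (e : V ≃ₗ[ℂ] W) (h : ∀ x v, e (ρ x v) = τ (φ x) (e v)) :
    Subrepresentation ρ ≃o Subrepresentation τ where
  toFun U := ⟨U.toSubmodule.map (e : V →ₗ[ℂ] W), by
    rintro g _ ⟨v, hv, rfl⟩
    refine ⟨ρ (φ.symm g) v, U.apply_mem_toSubmodule _ hv, ?_⟩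
    simpa using h (φ.symm g) v⟩
  invFun U := ⟨U.toSubmodule.comap (e : V →ₗ[ℂ] W), by
    intro g v hv
    have := U.apply_mem_toSubmodule (φ g) hv
    simpa [h] using this⟩
  left_inv U := by
    apply Subrepresentation.toSubmodule_injective
    exact Submodule.comap_map_eq_of_injective e.injective _
  right_inv U := by
    apply Subrepresentation.toSubmodule_injective
    exact Submodule.map_comap_eq_of_surjective e.surjective _
  map_rel_iff' {U U'} := by
    change U.toSubmodule.map (e : V →ₗ[ℂ] W) ≤ U'.toSubmodule.map (e : V →ₗ[ℂ] W) ↔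
      U.toSubmodule ≤ U'.toSubmodule
    exact Submodule.map_le_map_iff_of_injective e.injective _ _

/-- The character of an irreducible representation on a space in any universe is in `Irr`. -/
theorem character_mem_Irr {H V : Type*} [Group H] [AddCommGroup V] [Module ℂ V]
    [FiniteDimensional ℂ V] (ρ : Representation ℂ H V) (hρ : ρ.IsIrreducible) :
    ρ.character ∈ Irr H := by
  -- `Irr` only admits spaces in `Type`, so the representation is transported to coordinates.
  let e : V ≃ₗ[ℂ] (Fin (Module.finrank ℂ V) → ℂ) := (Module.finBasis ℂ V).equivFun
  let τ : Representation ℂ H (Fin (Module.finrank ℂ V) → ℂ) :=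
    (e.conjRingEquiv : _ →* _).comp ρ
  have h : ∀ x v, e (ρ x v) = τ x (e v) := fun x v => by
    simp [τ, LinearEquiv.conjRingEquiv]
  refine ⟨_, inferInstance, inferInstance, inferInstance, τ, ?_, ?_⟩
  · exact (OrderIso.isSimpleOrder_iff (subrepresentationOrderIso (MulEquiv.refl H) e h)).1 hρ
  · funext x
    exact LinearMap.trace_conj' (ρ x) e

/-- `Irr` is stable under composition with group automorphisms. -/
theorem comp_mem_Irr {H : Type*} [Group H] {χ : H → ℂ} (hχ : χ ∈ Irr H) (σ : MulAut H) :
    χ ∘ σ ∈ Irr H := by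
  obtain ⟨V, _, _, _, ρ, hρ, rfl⟩ := hχ
  refine ⟨V, inferInstance, inferInstance, inferInstance, ρ.comp (σ : H →* H), ?_, rfl⟩
  refine (OrderIso.isSimpleOrder_iff
    (subrepresentationOrderIso (τ := ρ) σ (LinearEquiv.refl ℂ V) fun x v => ?_)).2 hρ
  rfl

theorem one_mem_Irr (H : Type*) [Group H] : (1 : H → ℂ) ∈ Irr H := by
  refine ⟨ℂ, inferInstance, inferInstance, inferInstance, Representation.trivial ℂ H ℂ, ?_, ?_⟩
  · refine @IsSimpleOrder.mk _ _ _ ⟨⊥, ⊤, fun h => ?_⟩ fun U => ?_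
    · exact bot_ne_top (congrArg Subrepresentation.toSubmodule h)
    · rcases eq_bot_or_eq_top (α := Submodule ℂ ℂ) U.toSubmodule with h | h
      · exact Or.inl (Subrepresentation.toSubmodule_injective h)
      · exact Or.inr (Subrepresentation.toSubmodule_injective h)
  · funext x
    simp [Representation.character]

theorem Irr_apply_eq_of_isConj {H : Type*} [Group H] {χ : H → ℂ} (hχ : χ ∈ Irr H) {x y : H}
    (h : IsConj x y) : χ x = χ y := by
  obtain ⟨V, _, _, _, ρ, hρ, rfl⟩ := hχ
  obtain ⟨c, rfl⟩ := isConj_iff.1 h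
  exact (ρ.char_conj x c).symm

-- Isomorphic representations have equal characters, so distinct characters are orthogonal. When the
-- characters agree, one is replaced by the other, so it is not needed that characters determine
-- representations.
open scoped Classical in
theorem Irr_orthonormal {H : Type*} [Group H] [Fintype H] {χ ψ : H → ℂ} (hχ : χ ∈ Irr H)
    (hψ : ψ ∈ Irr H) :
    (Nat.card H : ℂ)⁻¹ * ∑ x, χ x * ψ x⁻¹ = if χ = ψ then 1 else 0 := by
  obtain ⟨V, _, _, _, ρ, hρ, rfl⟩ := hχ
  obtain ⟨W, _, _, _, τ, hτ, rfl⟩ := hψ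
  have : Invertible (Nat.card H : ℂ) := invertibleOfNonzero (by simp)
  by_cases h : ρ.character = τ.character
  · rw [if_pos h, ← h, char_orthonormal ρ ρ, if_pos ⟨Representation.Equiv.refl ρ⟩]
  · rw [if_neg h, char_orthonormal ρ τ, if_neg]
    rintro ⟨φ⟩
    exact h (char_iso φ).symm

/-! ### Completeness of the irreducible characters -/

/-- Schur: a class function orthogonal to an irreducible character acts as zero. -/
theorem sum_smul_eq_zero_of_orthogonal {H V : Type*} [Group H] [Fintype H] [AddCommGroup V]
    [Module ℂ V] [FiniteDimensional ℂ V] (ρ : Representation ℂ H V) [hρ : ρ.IsIrreducible]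
    {f : H → ℂ} (hf : ∀ x c, f (c * x * c⁻¹) = f x) (h : ∑ x, f x * ρ.character x⁻¹ = 0) :
    ∑ x, f x • ρ x⁻¹ = 0 := by
  set T : V →ₗ[ℂ] V := ∑ x, f x • ρ x⁻¹ with hT
  have hcomm : ∀ c, T ∘ₗ ρ c = ρ c ∘ₗ T := fun c => by
    change T * ρ c = ρ c * T
    rw [hT, Finset.sum_mul, Finset.mul_sum]
    refine Fintype.sum_equiv (MulAut.conj c⁻¹).toEquiv _ _ fun x => ?_
    simp only [MulEquiv.toEquiv_eq_coe, EquivLike.coe_coe, MulAut.conj_apply, hf,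
      smul_mul_assoc, mul_smul_comm, ← map_mul]
    congr 2
    simp [mul_assoc]
  obtain ⟨c, hc⟩ := (IsIrreducible.algebraMap_intertwiningMap_bijective_of_isAlgClosed
    (ρ := ρ)).2 ⟨T, hcomm⟩
  have hTc : T = c • LinearMap.id := by
    have := congrArg IntertwiningMap.toLinearMap hc
    exact this.symm
  have htr : LinearMap.trace ℂ V T = 0 := by
    rw [hT, map_sum, ← h]
    simp [Representation.character]
  -- The trace of the scalar `c` is `c * dim V`, so either `c = 0` or `V = 0`.
  rw [hTc, map_smul, LinearMap.trace_id, smul_eq_mul, mul_eq_zero] at htr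
  rcases htr with h0 | h0
  · rw [hTc, h0, zero_smul]
  · have := Module.finrank_zero_iff.1 (Nat.cast_eq_zero.1 h0)
    exact Subsingleton.elim _ _

/-- A class function orthogonal to all irreducible characters acts as zero on every
representation. -/
theorem sum_smul_eq_zero_of_orthogonal_Irr {H : Type*} [Group H] [Fintype H] {f : H → ℂ}
    (hf : ∀ x c, f (c * x * c⁻¹) = f x) (h : ∀ χ ∈ Irr H, ∑ x, f x * χ x⁻¹ = 0)
    {V : Type*} [AddCommGroup V] [Module ℂ V] [FiniteDimensional ℂ V] (ρ : Representation ℂ H V) :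
    ∑ x, f x • ρ x⁻¹ = 0 := by
  by_cases hV : Subsingleton V
  · exact Subsingleton.elim _ _
  by_cases hρ : ρ.IsIrreducible
  · exact sum_smul_eq_zero_of_orthogonal ρ hf (h _ (character_mem_Irr ρ hρ))
  -- Induction on dimension: the operator kills every proper subrepresentation, and by Maschke's
  -- theorem a reducible `V` is a sum of two of them.
  have key : ∀ U : Subrepresentation ρ, U ≠ ⊤ → ∀ v ∈ U, (∑ x, f x • ρ x⁻¹) v = 0 := by
    intro U hU v hv
    have hlt : Module.finrank ℂ U.toSubmodule < Module.finrank ℂ V :=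
      Submodule.finrank_lt fun h' => hU (Subrepresentation.toSubmodule_injective h')
    have h0 := LinearMap.congr_fun
      (sum_smul_eq_zero_of_orthogonal_Irr hf h U.toRepresentation) ⟨v, hv⟩
    have h1 := congrArg Subtype.val h0
    simpa [LinearMap.sum_apply, Subrepresentation.toRepresentation] using h1
  have hnt : (⊥ : Subrepresentation ρ) ≠ ⊤ := fun h' =>
    hV ((Submodule.subsingleton_iff ℂ).1
      (subsingleton_of_bot_eq_top (congrArg Subrepresentation.toSubmodule h')))
  obtain ⟨U, hbot, htop⟩ : ∃ U : Subrepresentation ρ, U ≠ ⊥ ∧ U ≠ ⊤ := by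
    by_contra! hcon
    exact hρ (@IsSimpleOrder.mk _ _ _ ⟨⊥, ⊤, hnt⟩ fun U => or_iff_not_imp_left.2 (hcon U))
  have : NeZero (Nat.card H : ℂ) := ⟨by simp⟩
  have hss : IsSemisimpleRepresentation ρ := inferInstance
  obtain ⟨U', hU'⟩ := exists_isCompl U
  have htop' : U' ≠ ⊤ := fun h' => hbot (by simpa [h'] using hU'.inf_eq_bot)
  ext v
  have hv : v ∈ U.toSubmodule ⊔ U'.toSubmodule := by
    rw [show U.toSubmodule ⊔ U'.toSubmodule = ⊤ from
      congrArg Subrepresentation.toSubmodule hU'.sup_eq_top]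
    trivial
  obtain ⟨u, hu, u', hu', rfl⟩ := Submodule.mem_sup.1 hv
  rw [map_add, key U htop u hu, key U' htop' u' hu']
  simp
termination_by Module.finrank ℂ V

/-- A class function orthogonal to all irreducible characters is zero. -/
theorem eq_zero_of_orthogonal_Irr {H : Type*} [Group H] [Fintype H] {f : H → ℂ}
    (hf : ∀ x c, f (c * x * c⁻¹) = f x) (h : ∀ χ ∈ Irr H, ∑ x, f x * χ x⁻¹ = 0) : f = 0 := by
  have h0 := LinearMap.congr_fun
    (sum_smul_eq_zero_of_orthogonal_Irr hf h (Representation.ofMulAction ℂ H H))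
    -- In the regular representation the operator sends the basis vector at `1` to `∑ f x • x⁻¹`,
    -- from which `f` is read off.
    (MonoidAlgebra.single 1 1)
  funext x
  have h1 := DFunLike.congr_fun (congrArg MonoidAlgebra.coeff h0) x⁻¹
  classical
  simpa [LinearMap.sum_apply, Finsupp.finsetSum_apply, Finsupp.single_apply] using h1

/-! ### The basis of irreducible characters -/

section

variable {H : Type*} [Group H]

/-- An irreducible character as a function on conjugacy classes. -/
def classFun (χ : Irr H) : ConjClasses H → ℂ :=
  Quotient.lift χ.1 fun _ _ h => Irr_apply_eq_of_isConj χ.2 h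

@[simp]
theorem classFun_mk (χ : Irr H) (x : H) : classFun χ (ConjClasses.mk x) = χ.1 x := rfl

/-- The pairing with an irreducible character on functions on conjugacy classes. -/
noncomputable def pairing [Fintype H] (ψ : Irr H) : (ConjClasses H → ℂ) →ₗ[ℂ] ℂ :=
  (Nat.card H : ℂ)⁻¹ • ∑ x : H, ψ.1 x⁻¹ • LinearMap.proj (ConjClasses.mk x)

theorem pairing_apply [Fintype H] (ψ : Irr H) (F : ConjClasses H → ℂ) :
    pairing ψ F = (Nat.card H : ℂ)⁻¹ * ∑ x, F (ConjClasses.mk x) * ψ.1 x⁻¹ := by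
  simp [pairing, LinearMap.sum_apply, mul_comm]

open scoped Classical in
theorem pairing_classFun [Fintype H] (ψ χ : Irr H) :
    pairing ψ (classFun χ) = if χ = ψ then 1 else 0 := by
  simp only [pairing_apply, classFun_mk, Irr_orthonormal χ.2 ψ.2, Subtype.ext_iff]

theorem linearIndependent_classFun [Finite H] :
    LinearIndependent ℂ (classFun : Irr H → ConjClasses H → ℂ) := by
  classical
  have := Fintype.ofFinite H
  refine linearIndependent_iff'.2 fun s c h ψ hψ => ?_
  have := congrArg (pairing ψ) h
  simpa [pairing_classFun, hψ] using this

instance finite_Irr [Finite H] : Finite (Irr H) :=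
  linearIndependent_classFun.finite

theorem span_classFun [Finite H] : ⊤ ≤ Submodule.span ℂ (Set.range (classFun (H := H))) := by
  classical
  have := Fintype.ofFinite H
  have := Fintype.ofFinite (Irr H)
  intro F _
  -- The defect of the Fourier expansion is orthogonal to every irreducible character, hence zero.
  let D : ConjClasses H → ℂ := F - ∑ χ : Irr H, pairing χ F • classFun χ
  have hD : ∀ ψ : Irr H, pairing ψ D = 0 := fun ψ => by
    simp [D, pairing_classFun]
  have h0 : (fun x : H => D (ConjClasses.mk x)) = 0 := by
    refine eq_zero_of_orthogonal_Irr (fun x c => ?_) fun χ hχ => ?_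
    · exact congrArg D (ConjClasses.mk_eq_mk_iff_isConj.2 (isConj_iff.2 ⟨c, rfl⟩).symm)
    · have := hD ⟨χ, hχ⟩
      rw [pairing_apply] at this
      exact (mul_eq_zero.1 this).resolve_left (by simp)
  have hF : F = ∑ χ : Irr H, pairing χ F • classFun χ := by
    refine sub_eq_zero.1 (funext fun c => ?_)
    obtain ⟨x, rfl⟩ := c.exists_rep
    exact congrFun h0 x
  rw [hF]
  exact Submodule.sum_mem _ fun χ _ =>
    Submodule.smul_mem _ _ (Submodule.subset_span (Set.mem_range_self χ))

/-- The irreducible characters form a basis of the space of class functions. -/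
noncomputable def irrBasis (H : Type*) [Group H] [Finite H] :
    Module.Basis (Irr H) ℂ (ConjClasses H → ℂ) :=
  Module.Basis.mk linearIndependent_classFun span_classFun

/-! ### Brauer's permutation lemma -/

/-- The trace of a linear map permuting a basis is the number of fixed basis vectors. -/
theorem trace_eq_card_fixedPoints {ι V : Type*} [Finite ι] [AddCommGroup V] [Module ℂ V]
    (b : Module.Basis ι ℂ V) (T : V →ₗ[ℂ] V) (s : ι → ι) (h : ∀ i, T (b i) = b (s i)) :
    LinearMap.trace ℂ V T = Nat.card {i // s i = i} := by
  classical
  have := Fintype.ofFinite ι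
  rw [LinearMap.trace_eq_matrix_trace ℂ b, Matrix.trace, Nat.card_eq_fintype_card,
    Fintype.card_subtype, Finset.card_filter]
  push_cast
  refine Finset.sum_congr rfl fun i _ => ?_
  simp [LinearMap.toMatrix_apply, h, Finsupp.single_apply]

/-- The action of automorphisms on conjugacy classes. -/
def conjClassesPerm (H : Type*) [Group H] : MulAut H →* Equiv.Perm (ConjClasses H) where
  toFun σ :=
    { toFun := ConjClasses.map (σ : H →* H)
      invFun := ConjClasses.map ((σ⁻¹ : MulAut H) : H →* H)
      left_inv := fun c => by
        obtain ⟨x, rfl⟩ := c.exists_rep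
        exact congrArg ConjClasses.mk (σ.symm_apply_apply x)
      right_inv := fun c => by
        obtain ⟨x, rfl⟩ := c.exists_rep
        exact congrArg ConjClasses.mk (σ.apply_symm_apply x) }
  map_one' := by
    ext c
    obtain ⟨x, rfl⟩ := c.exists_rep
    rfl
  map_mul' σ τ := by
    ext c
    obtain ⟨x, rfl⟩ := c.exists_rep
    rfl

@[simp]
theorem conjClassesPerm_mk (σ : MulAut H) (x : H) :
    conjClassesPerm H σ (ConjClasses.mk x) = ConjClasses.mk (σ x) := rfl

/-- The action of automorphisms on irreducible characters. -/
def irrPerm (H : Type*) [Group H] : MulAut H →* Equiv.Perm (Irr H) where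
  toFun σ :=
    { toFun := fun χ => ⟨χ.1 ∘ (σ⁻¹ : MulAut H), comp_mem_Irr χ.2 _⟩
      invFun := fun χ => ⟨χ.1 ∘ σ, comp_mem_Irr χ.2 _⟩
      left_inv := fun χ => Subtype.ext (funext fun x => congrArg χ.1 (σ.symm_apply_apply x))
      right_inv := fun χ => Subtype.ext (funext fun x => congrArg χ.1 (σ.apply_symm_apply x)) }
  map_one' := by
    ext χ x
    rfl
  map_mul' σ τ := by
    ext χ x
    simp

theorem irrPerm_apply (σ : MulAut H) (χ : Irr H) (x : H) :
    (irrPerm H σ χ).1 x = χ.1 (σ⁻¹ x) := rfl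

/-- Brauer's permutation lemma for an automorphism acting on classes and characters. -/
theorem card_fixed_conjClasses_eq_card_fixed_Irr [Finite H] (σ : MulAut H) :
    Nat.card {c // conjClassesPerm H σ c = c} = Nat.card {χ // irrPerm H σ χ = χ} := by
  classical
  -- Precomposition with `σ⁻¹` sends the indicator of `c` to that of `σ c`, and `χ` to `χ ∘ σ⁻¹`.
  let T : (ConjClasses H → ℂ) →ₗ[ℂ] (ConjClasses H → ℂ) :=
    LinearMap.funLeft ℂ ℂ (conjClassesPerm H σ⁻¹)
  have h1 := trace_eq_card_fixedPoints (Pi.basisFun ℂ (ConjClasses H)) T (conjClassesPerm H σ)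
    fun c => by
      funext d
      simp [T, LinearMap.funLeft_apply, Pi.single_apply, Equiv.symm_apply_eq]
  have h2 := trace_eq_card_fixedPoints (irrBasis H) T (irrPerm H σ) fun χ => by
      funext d
      obtain ⟨x, rfl⟩ := d.exists_rep
      simp only [T, LinearMap.funLeft_apply, irrBasis, Module.Basis.mk_apply, conjClassesPerm_mk,
        classFun_mk, irrPerm_apply]
  exact_mod_cast h1.symm.trans h2

end

/-! ### Counting fixed orbits and fixed points -/

/-- A twisted Burnside count: if `φ` is an action on `X` with orbit map `P` and `β` induces `b` on
orbits, then the fixed points of the maps `φ g ∘ β` count the `b`-fixed orbits. -/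
theorem sum_card_fixed_eq_card_mul_card_fixed {G X Z : Type*} [Group G] [Fintype G] [Finite X]
    (φ : G →* Equiv.Perm X) (β : X → X) (P : X → Z) (hP : Function.Surjective P)
    (hφ : ∀ x y, P x = P y ↔ ∃ g, φ g x = y) (b : Z → Z) (hb : ∀ x, P (β x) = b (P x)) :
    ∑ g, Nat.card {x // φ g (β x) = x} = Nat.card G * Nat.card {z // b z = z} := by
  obtain ⟨s, hs⟩ := hP.hasRightInverse
  -- For `x` in a `b`-fixed orbit, `t x` carries the chosen representative `s (P x)` to `β x`;
  -- elsewhere its value is irrelevant.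
  have hex : ∀ x, ∃ h, b (P x) = P x → φ h (s (P x)) = β x := fun x => by
    by_cases hx : b (P x) = P x
    · obtain ⟨h, hh⟩ := (hφ (s (P x)) (β x)).1 (by rw [hs, hb, hx])
      exact ⟨h, fun _ => hh⟩
    · exact ⟨1, fun h => absurd h hx⟩
  choose t ht using hex
  have hfix : ∀ g x, φ g (β x) = x → b (P x) = P x := fun g x h => by
    rw [← hb]
    exact (hφ _ _).2 ⟨g, h⟩
  have hrec : ∀ g x, φ g (β x) = x → φ (g * t x) (s (P x)) = x := fun g x h => by
    rw [map_mul, Equiv.Perm.mul_apply, ht x (hfix g x h), h]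
  -- If `φ g (β x) = x`, then `k = g * t x` carries `s (P x)` to `x`. So `k` and the orbit determine
  -- `x`, and then `g = k * (t x)⁻¹`.
  let f : (Σ g, {x // φ g (β x) = x}) → G × {z // b z = z} :=
    fun p => (p.1 * t p.2.1, ⟨P p.2.1, hfix p.1 p.2.1 p.2.2⟩)
  have hf : Function.Bijective f := by
    constructor
    · rintro ⟨g, x, h⟩ ⟨g', x', h'⟩ heq
      obtain ⟨h1, h2⟩ := Prod.ext_iff.1 heq
      have h2' : P x = P x' := congrArg Subtype.val h2
      have h1' : g * t x = g' * t x' := h1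
      have hx : x = x' := by
        rw [← hrec g x h, ← hrec g' x' h', h1', h2']
      subst hx
      obtain rfl := mul_right_cancel h1'
      rfl
    · rintro ⟨k, z, hz⟩
      have hPx : P (φ k (s z)) = z := ((hφ _ _).2 ⟨k, rfl⟩).symm.trans (hs z)
      have htx := ht (φ k (s z)) (by rw [hPx, hz])
      rw [hPx] at htx
      refine ⟨⟨k * (t (φ k (s z)))⁻¹, φ k (s z), ?_⟩, ?_⟩
      · rw [← htx, ← Equiv.Perm.mul_apply, ← map_mul, inv_mul_cancel_right]
      · simp [f, hPx]
  have := Nat.card_congr (Equiv.ofBijective f hf)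
  rwa [Nat.card_sigma, Nat.card_prod] at this

theorem forall_eq_iff_card_eq_one {X : Type*} {p : X → Prop} {x₀ : X} (h₀ : p x₀) :
    (∀ x, p x → x = x₀) ↔ Nat.card {x // p x} = 1 := by
  rw [Nat.card_eq_one_iff_exists]
  constructor
  · exact fun h => ⟨⟨x₀, h₀⟩, fun y => Subtype.ext (h y y.2)⟩
  · rintro ⟨y, hy⟩ x hx
    exact congrArg Subtype.val ((hy ⟨x, hx⟩).trans (hy ⟨x₀, h₀⟩).symm)

/-- An automorphism fixes only the trivial class iff it fixes only the principal character. -/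
theorem forall_fixed_conjClasses_iff_forall_fixed_Irr {H : Type*} [Group H] [Finite H]
    (σ : MulAut H) :
    (∀ x : H, IsConj (σ x) x → x = 1) ↔ ∀ χ ∈ Irr H, χ ∘ σ = χ → χ = 1 := by
  have h1 : conjClassesPerm H σ (ConjClasses.mk 1) = ConjClasses.mk 1 := by simp
  have h2 : irrPerm H σ ⟨1, one_mem_Irr H⟩ = ⟨1, one_mem_Irr H⟩ := rfl
  have hl : (∀ x : H, IsConj (σ x) x → x = 1) ↔
      ∀ c, conjClassesPerm H σ c = c → c = ConjClasses.mk 1 := by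
    rw [ConjClasses.forall_isConj]
    simp [ConjClasses.mk_eq_mk_iff_isConj]
  have hr : (∀ χ ∈ Irr H, χ ∘ σ = χ → χ = 1) ↔
      ∀ χ, irrPerm H σ χ = χ → χ = ⟨1, one_mem_Irr H⟩ := by
    rw [Subtype.forall]
    refine forall₂_congr fun χ hχ => ?_
    have : irrPerm H σ ⟨χ, hχ⟩ = ⟨χ, hχ⟩ ↔ χ ∘ σ = χ := by
      rw [eq_comm, ← Equiv.symm_apply_eq, Subtype.ext_iff]
      rfl
    rw [this, Subtype.ext_iff]
  -- Since the trivial class and the principal character are always fixed, both sides say that the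
  -- number of fixed objects is one.
  rw [hl, hr, forall_eq_iff_card_eq_one (p := fun c => conjClassesPerm H σ c = c) h1,
    forall_eq_iff_card_eq_one (p := fun χ => irrPerm H σ χ = χ) h2,
    card_fixed_conjClasses_eq_card_fixed_Irr]

/-! ### Frobenius triples -/

section

variable {G : Type*} [Group G]

theorem isFrobeniusTriple_iff [Finite G] (N M : Subgroup G) [N.Normal] [M.Normal] (hMN : M ≤ N)
    (hM : M ≠ ⊥) (hN : N ≠ ⊤) :
    IsFrobeniusTriple N M ↔ ∀ θ ∈ Irr M, θ ≠ 1 → stabilizer M θ ≤ N := by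
  have hfix := fun g : G =>
    forall_fixed_conjClasses_iff_forall_fixed_Irr (MulAut.conjNormal g : MulAut M)
  constructor
  · intro h θ hθ hθ1 g hg
    by_contra hgN
    refine hθ1 ((hfix g).1 (fun x hx => ?_) θ hθ hg)
    by_contra hx1
    obtain ⟨c, hc⟩ := isConj_iff.1 hx
    have hcx : (c : G) * (g * x * g⁻¹) * (c : G)⁻¹ = x := by
      simpa using congrArg Subtype.val hc
    -- If `g` fixes the `M`-class of `x`, correcting `g` by some `c ∈ M` gives an element that
    -- centralizes `x`, without changing whether it lies in `N`.
    have hmem : (c : G) * g ∈ Subgroup.centralizer {(x : G)} := by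
      rw [Subgroup.mem_centralizer_singleton_iff]
      nth_rewrite 2 [← hcx]
      group
    have := h.centralizer_le x x.2 (by simpa using hx1) hmem
    exact hgN ((N.mul_mem_cancel_left (hMN c.2)).1 this)
  · intro h
    refine ⟨inferInstance, inferInstance, hMN, hM, fun hM' => hN (top_le_iff.1 (hM' ▸ hMN)),
      fun hN' => hM (le_bot_iff.1 (hN' ▸ hMN)), hN, fun x hx hx1 g hg => ?_⟩
    by_contra hgN
    -- Outside `N`, `g` fixes no nonprincipal character, so it fixes no nontrivial class of `M`; but
    -- it centralizes `x`.
    have := (hfix g).2 (fun χ hχ hg' => by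
      by_contra hχ1
      exact hgN (h χ hχ hχ1 hg')) ⟨x, hx⟩ (by
        have : (MulAut.conjNormal g : MulAut M) ⟨x, hx⟩ = ⟨x, hx⟩ := by
          ext
          rw [Subgroup.mem_centralizer_singleton_iff] at hg
          simp [hg]
        rw [this])
    exact hx1 (congrArg Subtype.val this)

/-! ### `G`-classes in `N` and `G`-orbits of characters as orbits of conjugation -/

/-- The map from the conjugacy classes of `N` to the `G`-classes contained in `N`. -/
def toCl (N : Subgroup G) : ConjClasses N → Cl N :=
  Quotient.lift (fun n : N => ⟨conjugatesOf (n : G), n, n.2, rfl⟩) fun _ _ h =>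
    Subtype.ext (N.subtype.map_isConj h).conjugatesOf_eq

@[simp]
theorem coe_toCl_mk (N : Subgroup G) (n : N) :
    (toCl N (ConjClasses.mk n) : Set G) = conjugatesOf (n : G) := rfl

theorem toCl_surjective (N : Subgroup G) : Function.Surjective (toCl N) := by
  rintro ⟨_, n, hn, rfl⟩
  exact ⟨ConjClasses.mk ⟨n, hn⟩, rfl⟩

theorem toCl_eq_iff (N : Subgroup G) [N.Normal] (c d : ConjClasses N) :
    toCl N c = toCl N d ↔
      ∃ g : G, (conjClassesPerm N).comp MulAut.conjNormal g c = d := by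
  obtain ⟨x, rfl⟩ := c.exists_rep
  obtain ⟨y, rfl⟩ := d.exists_rep
  rw [Subtype.ext_iff, coe_toCl_mk, coe_toCl_mk, ← isConj_iff_conjugatesOf_eq]
  constructor
  · intro h
    obtain ⟨g, hg⟩ := isConj_iff.1 h
    refine ⟨g, congrArg ConjClasses.mk (Subtype.ext ?_)⟩
    simpa using hg
  · rintro ⟨g, hg⟩
    have h1 := N.subtype.map_isConj (ConjClasses.mk_eq_mk_iff_isConj.1 hg)
    refine IsConj.trans (isConj_iff.2 ⟨g, ?_⟩) h1
    simp

/-- The map from an irreducible character to its `G`-orbit. -/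
def toIrrOrb (N : Subgroup G) [N.Normal] (χ : Irr N) : IrrOrb N :=
  ⟨orb N χ.1, χ.1, χ.2, rfl⟩

theorem toIrrOrb_surjective (N : Subgroup G) [N.Normal] : Function.Surjective (toIrrOrb N) := by
  rintro ⟨_, ψ, hψ, rfl⟩
  exact ⟨⟨ψ, hψ⟩, rfl⟩

theorem conjFun_conjFun (N : Subgroup G) [N.Normal] (ψ : N → ℂ) (g h : G) :
    conjFun N (conjFun N ψ g) h = conjFun N ψ (g * h) := by
  funext n
  simp [conjFun]

theorem orb_conjFun (N : Subgroup G) [N.Normal] (ψ : N → ℂ) (g : G) :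
    orb N (conjFun N ψ g) = orb N ψ := by
  ext θ
  constructor
  · rintro ⟨h, rfl⟩
    exact ⟨g * h, (conjFun_conjFun N ψ g h).symm⟩
  · rintro ⟨h, rfl⟩
    exact ⟨g⁻¹ * h, by rw [conjFun_conjFun, mul_inv_cancel_left]⟩

/-- The inverse appears because `irrPerm` is a left action, whereas `ψ^g` is a right action. -/
theorem coe_irrPerm_conjNormal (N : Subgroup G) [N.Normal] (g : G) (χ : Irr N) :
    ((irrPerm N).comp MulAut.conjNormal g χ).1 = conjFun N χ.1 g⁻¹ := by
  funext n
  simp [irrPerm_apply, conjFun]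

theorem toIrrOrb_eq_iff (N : Subgroup G) [N.Normal] (χ ψ : Irr N) :
    toIrrOrb N χ = toIrrOrb N ψ ↔ ∃ g : G, (irrPerm N).comp MulAut.conjNormal g χ = ψ := by
  simp only [Subtype.ext_iff, coe_irrPerm_conjNormal]
  constructor
  · intro h
    have h' : orb N χ.1 = orb N ψ.1 := h
    obtain ⟨g, hg⟩ : ψ.1 ∈ orb N χ.1 := h' ▸ ⟨1, by funext n; simp [conjFun]⟩
    exact ⟨g⁻¹, by rwa [inv_inv]⟩
  · rintro ⟨g, hg⟩
    change orb N χ.1 = orb N ψ.1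
    rw [← hg, orb_conjFun]

/-! ### The action of `A` and its fixed points -/

variable {A : Type*} [Group A] [MulDistribMulAction A G]

/-- The automorphism of an `A`-invariant subgroup induced by an element of `A`. -/
def actAut (N : Subgroup G) (hN : ∀ (a : A), ∀ n ∈ N, a • n ∈ N) (a : A) : MulAut N where
  toFun n := ⟨a • (n : G), hN a n n.2⟩
  invFun n := ⟨a⁻¹ • (n : G), hN a⁻¹ n n.2⟩
  left_inv n := by simp
  right_inv n := by simp
  map_mul' m n := by ext; simp

theorem actFun_eq_comp (N : Subgroup G) (hN : ∀ (a : A), ∀ n ∈ N, a • n ∈ N) (a : A)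
    (ψ : N → ℂ) : actFun N hN a ψ = ψ ∘ ((actAut N hN a)⁻¹ : MulAut N) := rfl

theorem actFun_mem_Irr (N : Subgroup G) (hN : ∀ (a : A), ∀ n ∈ N, a • n ∈ N) (a : A)
    {ψ : N → ℂ} (hψ : ψ ∈ Irr N) : actFun N hN a ψ ∈ Irr N :=
  actFun_eq_comp N hN a ψ ▸ comp_mem_Irr hψ _

/-- This compatibility makes `a` carry `G`-orbits of characters onto `G`-orbits. -/
theorem actFun_conjFun (N : Subgroup G) [N.Normal] (hN : ∀ (a : A), ∀ n ∈ N, a • n ∈ N) (a : A)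
    (ψ : N → ℂ) (g : G) :
    actFun N hN a (conjFun N ψ g) = conjFun N (actFun N hN a ψ) (a • g) := by
  funext n
  refine congrArg ψ (Subtype.ext ?_)
  simp

theorem image_actFun_orb (N : Subgroup G) [N.Normal] (hN : ∀ (a : A), ∀ n ∈ N, a • n ∈ N) (a : A)
    (ψ : N → ℂ) : actFun N hN a '' orb N ψ = orb N (actFun N hN a ψ) := by
  ext θ
  constructor
  · rintro ⟨_, ⟨g, rfl⟩, rfl⟩
    exact ⟨a • g, (actFun_conjFun N hN a ψ g).symm⟩
  · rintro ⟨g, rfl⟩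
    exact ⟨_, ⟨a⁻¹ • g, rfl⟩, by rw [actFun_conjFun, smul_inv_smul]⟩

theorem image_smul_conjugatesOf (a : A) (n : G) :
    (a • ·) '' conjugatesOf n = conjugatesOf (a • n) := by
  ext x
  simp only [Set.mem_image, conjugatesOf, Set.mem_ofPred_eq, isConj_iff]
  constructor
  · rintro ⟨_, ⟨g, rfl⟩, rfl⟩
    exact ⟨a • g, by simp⟩
  · rintro ⟨g, rfl⟩
    exact ⟨_, ⟨a⁻¹ • g, rfl⟩, by simp⟩

/-- The action of `A` on `Cl_G(N)`. -/
@[reducible]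
def clMulAction (N : Subgroup G) (hN : ∀ (a : A), ∀ n ∈ N, a • n ∈ N) : MulAction A (Cl N) where
  smul a κ := ⟨(a • ·) '' κ.1, by
    obtain ⟨n, hn, h⟩ := κ.2
    exact ⟨a • n, hN a n hn, by rw [← h, image_smul_conjugatesOf]⟩⟩
  one_smul κ := Subtype.ext (by
    change ((1 : A) • ·) '' κ.1 = κ.1
    simp)
  mul_smul a b κ := Subtype.ext (by
    change ((a * b) • ·) '' κ.1 = (a • ·) '' ((b • ·) '' κ.1)
    simp only [Set.image_image, mul_smul])

/-- The action of `A` on `Irr_G(N)`. -/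
@[reducible]
def irrOrbMulAction (N : Subgroup G) [N.Normal] (hN : ∀ (a : A), ∀ n ∈ N, a • n ∈ N) :
    MulAction A (IrrOrb N) where
  smul a l := ⟨actFun N hN a '' l.1, by
    obtain ⟨ψ, hψ, h⟩ := l.2
    exact ⟨actFun N hN a ψ, actFun_mem_Irr N hN a hψ, by rw [← h, image_actFun_orb]⟩⟩
  one_smul l := Subtype.ext (by
    change actFun N hN 1 '' l.1 = l.1
    have : actFun N hN 1 = id := by
      funext ψ n
      simp [actFun]
    rw [this, Set.image_id])
  mul_smul a b l := Subtype.ext (by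
    change actFun N hN (a * b) '' l.1 = actFun N hN a '' (actFun N hN b '' l.1)
    rw [Set.image_image]
    congr 1
    funext ψ n
    simp [actFun, mul_smul])

/-- The twisted Burnside count expresses `|G|` times each side as a sum over `g`. The two sums agree
term by term, by Brauer's lemma for the automorphism `n ↦ g α(n) g⁻¹` of `N`. -/
theorem card_fixed_Cl_eq_card_fixed_IrrOrb [Finite G] (N : Subgroup G) [N.Normal] (α : MulAut N)
    (b : Cl N → Cl N) (hb : ∀ c, toCl N (conjClassesPerm N α c) = b (toCl N c))
    (b' : IrrOrb N → IrrOrb N) (hb' : ∀ χ, toIrrOrb N (irrPerm N α χ) = b' (toIrrOrb N χ)) :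
    Nat.card {κ // b κ = κ} = Nat.card {l // b' l = l} := by
  have := Fintype.ofFinite G
  have h1 := sum_card_fixed_eq_card_mul_card_fixed ((conjClassesPerm N).comp MulAut.conjNormal) _
    (toCl N) (toCl_surjective N) (toCl_eq_iff N) b hb
  have h2 := sum_card_fixed_eq_card_mul_card_fixed ((irrPerm N).comp MulAut.conjNormal) _
    (toIrrOrb N) (toIrrOrb_surjective N) (toIrrOrb_eq_iff N) b' hb'
  refine Nat.eq_of_mul_eq_mul_left (Nat.card_pos (α := G)) ?_
  rw [← h1, ← h2]
  refine Finset.sum_congr rfl fun g _ => ?_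
  have h3 := card_fixed_conjClasses_eq_card_fixed_Irr (MulAut.conjNormal g * α : MulAut N)
  simpa only [map_mul, Equiv.Perm.mul_apply, MonoidHom.comp_apply] using h3

end

end FrobeniusTriple

open FrobeniusTriple in
theorem mainTheorem9 {G : Type*} [Group G] [Finite G] :
    (∀ (N M : Subgroup G) [N.Normal] [M.Normal], M ≤ N → M ≠ ⊥ → N ≠ ⊤ →
      (IsFrobeniusTriple N M ↔
        ∀ θ ∈ Irr M, θ ≠ 1 → FrobeniusTriple.stabilizer M θ ≤ N)) ∧
    (∀ (N : Subgroup G) [N.Normal] {A : Type*} [Group A] [MulDistribMulAction A G]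
      (hN : ∀ (a : A), ∀ n ∈ N, a • n ∈ N),
      ∃ (_ : MulAction A (Cl N)) (_ : MulAction A (IrrOrb N)),
        (∀ (a : A) (κ : Cl N) (n : G), n ∈ N → (κ : Set G) = conjugatesOf n →
          ((a • κ : Cl N) : Set G) = conjugatesOf (a • n)) ∧
        (∀ (a : A) (l : IrrOrb N) (ψ : N → ℂ), ψ ∈ Irr N → (l : Set (N → ℂ)) = orb N ψ →
          actFun N hN a ψ ∈ Irr N ∧
          ((a • l : IrrOrb N) : Set (N → ℂ)) = orb N (actFun N hN a ψ)) ∧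
        ∀ a : A, (MulAction.fixedBy (Cl N) a).Finite ∧ (MulAction.fixedBy (IrrOrb N) a).Finite ∧
          (MulAction.fixedBy (Cl N) a).ncard = (MulAction.fixedBy (IrrOrb N) a).ncard) := by
  refine ⟨fun N M _ _ => isFrobeniusTriple_iff N M, fun N _ A _ _ hN => ?_⟩
  let := clMulAction N hN
  let := irrOrbMulAction N hN
  refine ⟨clMulAction N hN, irrOrbMulAction N hN, fun a κ n _ hκ => ?_,
    fun a l ψ hψ hl => ⟨actFun_mem_Irr N hN a hψ, ?_⟩, fun a => ⟨?_, ?_, ?_⟩⟩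
  · change (a • ·) '' κ.1 = _
    rw [hκ, image_smul_conjugatesOf]
  · change actFun N hN a '' l.1 = _
    rw [hl, image_actFun_orb]
  · have := Finite.of_surjective _ (toCl_surjective N)
    exact Set.toFinite _
  · have := Finite.of_surjective _ (toIrrOrb_surjective N)
    exact Set.toFinite _
  · refine card_fixed_Cl_eq_card_fixed_IrrOrb N (actAut N hN a) (a • ·) (fun c => ?_) (a • ·)
      fun χ => Subtype.ext (image_actFun_orb N hN a χ.1).symm
    obtain ⟨n, rfl⟩ := c.exists_rep
    exact Subtype.ext (image_smul_conjugatesOf a (n : G)).symm
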